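/- Let $L^2$ be the space of square-integrable functions on the unit circle $\mathbb T$ with normalized Lebesgue measure, and let $H^2\subset L^2$ be the Hardy space of the unit disk $\mathbb D$, identified with a subspace of $L^2$ via boundary values. Let $\theta$ be an inner function, that is, $\theta\in H^2$ and $|\theta|=1$ almost everywhere on $\mathbb T$. Let $K_\theta=H^2\ominus\theta H^2$, let $P_\theta$ be the orthogonal projection from $L^2$ onto $K_\theta$, and let $S_\theta: K_\theta\to K_\theta$, $S_\theta f=P_\theta(zf)$. For $\lambda\in\mathbb D$ let $$k_\lambda=\frac{1-\overline{\theta(\lambda)}\,\theta}{1-\bar\lambda z}\in K_\theta$$ be the reproducing kernel of $K_\theta$ at $\lambda$, and let $\bar\partial^{\,n}k_0\in K_\theta$ be the value at $\lambda=0$ of the $n$-th derivative of $k_\lambda$ with respect to $\bar\lambda$, taken in the norm of $K_\theta$ (with $\bar\partial^{\,0}k_0=k_0$). Let $A$ be a bounded truncated Toeplitz operator on $K_\theta$, that is, a bounded linear operator on $K_\theta$ for which there is $\phi\in L^2$ with $Af=P_\theta(\phi f)$ for all $f\in K_\theta\cap L^\infty$. Let $\overline{\operatorname{Ran}A}$ be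 the closure of its range, and assume that $\overline{\operatorname{Ran}A}\neq K_\theta$. Then there is a largest integer $n\ge 0$ such that $\bar\partial^{\,j}k_0\in\overline{\operatorname{Ran}A}$ for all $0\le j<n$, and for this $n$ the sum of $\overline{\operatorname{Ran}A}$ and the linear span $\langle\bar\partial^{\,n}k_0\rangle$ is direct and $$S_\theta\,\overline{\operatorname{Ran}A}\subset\overline{\operatorname{Ran}A}\dotplus\langle\bar\partial^{\,n}k_0\rangle .$$ -/

import Mathlib

noncomputable section

open MeasureTheory AddCircle Filter
open scoped ENNReal ComplexConjugate InnerProductSpace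

namespace TruncatedToeplitz

/-- The space `L²` on the unit circle. The circle is parametrized by `UnitAddCircle = ℝ/ℤ`, the
independent variable is `z = fourier 1`, that is `x ↦ exp(2πix)`, and the measure is normalized
Lebesgue measure. -/
abbrev L2 : Type := Lp ℂ 2 (haarAddCircle : Measure UnitAddCircle)

/-- The Hardy space `H²`, as the subspace of `L²` of all functions whose Fourier coefficients of
negative index vanish. -/
def H2 : Submodule ℂ L2 where
  carrier := {f | ∀ n : ℤ, n < 0 → fourierCoeff (f : UnitAddCircle → ℂ) n = 0}
  zero_mem' n _ := by
    rw [← fourierBasis_repr]; simp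
  add_mem' {f g} hf hg n hn := by
    have h1 := hf n hn
    have h2 := hg n hn
    rw [← fourierBasis_repr] at h1 h2 ⊢
    simp [h1, h2]
  smul_mem' c f hf n hn := by
    have h1 := hf n hn
    rw [← fourierBasis_repr] at h1 ⊢
    simp [h1]

theorem isClosed_H2 : IsClosed (H2 : Set L2) := by
  have : (H2 : Set L2) = ⋂ n : ℤ, ⋂ _ : n < 0,
      {f : L2 | ⟪fourierBasis (T := 1) n, f⟫_ℂ = 0} := by
    ext f
    simp only [Set.mem_iInter, Set.mem_ofPred_eq]
    refine forall₂_congr fun n _ => ?_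
    rw [← fourierBasis.repr_apply_apply f n, fourierBasis_repr]
  rw [this]
  exact isClosed_iInter fun n => isClosed_iInter fun _ =>
    isClosed_eq (continuous_const.inner continuous_id) continuous_const

/-- The value at a point `w` of the unit disk of the analytic function `∑ aₙ zⁿ` with boundary
function `f ∈ H²`. -/
def diskValue (f : L2) (w : ℂ) : ℂ :=
  ∑' n : ℕ, fourierCoeff (f : UnitAddCircle → ℂ) (n : ℤ) * w ^ n

/-- Inner functions: functions in `H²` that are unimodular almost everywhere on the circle. -/
structure IsInner (θ : L2) : Prop where
  mem_H2 : θ ∈ H2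
  norm_eq_one : ∀ᵐ x ∂(haarAddCircle : Measure UnitAddCircle), ‖θ x‖ = 1

/-- The subspace `θ H²`. -/
def thetaH2 (θ : L2) : Submodule ℂ L2 where
  carrier := {h | ∃ g ∈ H2, h =ᵐ[haarAddCircle] fun x => θ x * g x}
  zero_mem' := ⟨0, H2.zero_mem, by
    filter_upwards [Lp.coeFn_zero ℂ 2 (haarAddCircle : Measure UnitAddCircle)] with x hx
    rw [hx]; simp⟩
  add_mem' := by
    rintro h₁ h₂ ⟨g₁, hg₁, e₁⟩ ⟨g₂, hg₂, e₂⟩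
    refine ⟨g₁ + g₂, H2.add_mem hg₁ hg₂, ?_⟩
    filter_upwards [e₁, e₂, Lp.coeFn_add h₁ h₂, Lp.coeFn_add g₁ g₂] with x a b c d
    rw [c, d, Pi.add_apply, Pi.add_apply, a, b, mul_add]
  smul_mem' := by
    rintro c h ⟨g, hg, e⟩
    refine ⟨c • g, H2.smul_mem c hg, ?_⟩
    filter_upwards [e, Lp.coeFn_smul c h, Lp.coeFn_smul c g] with x a b d
    rw [b, d, Pi.smul_apply, Pi.smul_apply, a, smul_eq_mul, smul_eq_mul]; ring

/-- The model space `K_θ = H² ⊖ θ H²`. -/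
def K (θ : L2) : Submodule ℂ L2 := H2 ⊓ (thetaH2 θ)ᗮ

instance (θ : L2) : CompleteSpace (K θ) :=
  (isClosed_H2.inter (thetaH2 θ).isClosed_orthogonal).completeSpace_coe

/-- The orthogonal projection `P_θ` from `L²` onto `K_θ`. -/
def P (θ : L2) : L2 →L[ℂ] K θ := (K θ).orthogonalProjectionOnto

/-- Multiplication by the independent variable `z` on `L²`. -/
def Mz : L2 →L[ℂ] L2 :=
  (ContinuousLinearMap.mul ℂ ℂ).holderL haarAddCircle ∞ 2 2 (fourierLp ∞ 1)

/-- The restricted shift `S_θ f = P_θ (z f)`. -/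
def S (θ : L2) : K θ →L[ℂ] K θ := P θ ∘L Mz ∘L (K θ).subtypeL

/-- `A` is a bounded truncated Toeplitz operator on `K_θ`: there is a symbol `φ ∈ L²` such that
`A f = P_θ (φ f)` for all `f ∈ K_θ ∩ L^∞`. -/
def IsTruncatedToeplitz (θ : L2) (A : K θ →L[ℂ] K θ) : Prop :=
  ∃ φ : L2, ∀ (f : K θ) (hf : MemLp (f : L2) ∞ haarAddCircle),
    A f = P θ ((hf.mul' (Lp.memLp φ) : MemLp (fun x => φ x * (f : L2) x) 2 haarAddCircle).toLp)

/-- The function `(1 - conj θ(w) θ) / (1 - conj w z)` on the circle. -/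
def kernelFun (θ : L2) (w : ℂ) (x : UnitAddCircle) : ℂ :=
  (1 - conj (diskValue θ w) * θ x) / (1 - conj w * fourier 1 x)

theorem norm_fourier_apply (n : ℤ) (x : UnitAddCircle) : ‖(fourier n x : ℂ)‖ = 1 := by
  rw [fourier_apply]
  exact Circle.norm_coe _

theorem norm_conj_mul_fourier_lt {w : ℂ} (hw : ‖w‖ < 1) (x : UnitAddCircle) :
    ‖conj w * fourier 1 x‖ < 1 := by
  rw [norm_mul, norm_fourier_apply, mul_one, RCLike.norm_conj]
  exact hw

theorem continuous_inv_kernel {w : ℂ} (hw : ‖w‖ < 1) :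
    Continuous fun x : UnitAddCircle => (1 - conj w * fourier 1 x)⁻¹ := by
  refine Continuous.inv₀ (by fun_prop) fun x h => ?_
  have h1 := norm_conj_mul_fourier_lt hw x
  rw [← sub_eq_zero.mp h] at h1
  simp at h1

theorem memLp_kernelFun (θ : L2) {w : ℂ} (hw : ‖w‖ < 1) :
    MemLp (kernelFun θ w) 2 (haarAddCircle : Measure UnitAddCircle) := by
  have h1 : MemLp (fun x : UnitAddCircle => (1 - conj w * fourier 1 x)⁻¹) ∞ haarAddCircle :=
    BoundedContinuousFunction.memLp_top
      (BoundedContinuousFunction.mkOfCompact ⟨_, continuous_inv_kernel hw⟩)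
  have h2 : MemLp (fun x => 1 - conj (diskValue θ w) * θ x) 2
      (haarAddCircle : Measure UnitAddCircle) :=
    (memLp_const 1).sub ((Lp.memLp θ).const_mul _)
  exact h1.mul' h2

theorem hasSum_integral_div (F : UnitAddCircle → ℂ) (hF : Integrable F haarAddCircle) {w : ℂ}
    (hw : ‖w‖ < 1) :
    HasSum (fun m : ℕ => conj w ^ m * ∫ x, fourier (m : ℤ) x * F x ∂haarAddCircle)
      (∫ x, F x / (1 - conj w * fourier 1 x) ∂haarAddCircle) := by
  have hint : ∀ m : ℕ, Integrable (fun x => (conj w * fourier 1 x) ^ m * F x)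
      (haarAddCircle : Measure UnitAddCircle) := fun m =>
    hF.bdd_mul (c := 1) (by fun_prop) (Eventually.of_forall fun x => by
      rw [norm_pow]
      exact pow_le_one₀ (norm_nonneg _) (norm_conj_mul_fourier_lt hw x).le)
  have key := hasSum_integral_of_summable_integral_norm hint (by
    have : ∀ m : ℕ, ∫ x, ‖(conj w * fourier 1 x) ^ m * F x‖ ∂haarAddCircle
        = ‖w‖ ^ m * ∫ x, ‖F x‖ ∂haarAddCircle := fun m => by
      rw [← integral_const_mul]
      congr 1; ext x
      rw [norm_mul, norm_pow, norm_mul, norm_fourier_apply, mul_one, RCLike.norm_conj]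
    simp_rw [this]
    exact (summable_geometric_of_lt_one (norm_nonneg _) hw).mul_right _)
  have e1 : (fun m : ℕ => conj w ^ m * ∫ x, fourier (m : ℤ) x * F x ∂haarAddCircle)
      = fun m : ℕ => ∫ x, (conj w * fourier 1 x) ^ m * F x ∂haarAddCircle := by
    ext m
    rw [← integral_const_mul]
    congr 1; ext x
    have : (fourier (m : ℤ) x : ℂ) = (fourier 1 x) ^ m := by
      simp [fourier_apply, toCircle_nsmul]
    rw [this, mul_pow]; ring
  have e2 : ∫ x, F x / (1 - conj w * fourier 1 x) ∂haarAddCircle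
      = ∫ x, ∑' m : ℕ, (conj w * fourier 1 x) ^ m * F x ∂haarAddCircle := by
    congr 1; ext x
    rw [tsum_mul_right, tsum_geometric_of_norm_lt_one (norm_conj_mul_fourier_lt hw x)]
    rw [div_eq_mul_inv, mul_comm]
  rw [e1, e2]
  exact key

theorem integral_fourier_mul (m i : ℤ) (f : UnitAddCircle → ℂ) :
    ∫ x, fourier m x * (fourier (-i) x * f x) ∂haarAddCircle = fourierCoeff f (i - m) := by
  rw [fourierCoeff]
  congr 1; ext x
  rw [← mul_assoc, ← fourier_add, smul_eq_mul, neg_sub, sub_eq_add_neg]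

theorem fourierCoeff_conj (f : UnitAddCircle → ℂ) (n : ℤ) :
    fourierCoeff (fun x => conj (f x)) n = conj (fourierCoeff f (-n)) := by
  rw [fourierCoeff, fourierCoeff, ← integral_conj]
  congr 1; ext x
  simp

theorem fourierCoeff_one (n : ℤ) :
    fourierCoeff (fun _ : UnitAddCircle => (1 : ℂ)) n = if n = 0 then 1 else 0 := by
  have h := congrFun (fourierCoeff_fourier (T := 1) 0) n
  rw [Pi.single_apply] at h
  rw [← h]
  congr 1; ext x
  simp

theorem norm_fourierCoeff_le (f : L2) (n : ℤ) :
    ‖fourierCoeff (f : UnitAddCircle → ℂ) n‖ ≤ ‖f‖ := by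
  rw [← fourierBasis_repr, fourierBasis.repr_apply_apply]
  refine (norm_inner_le_norm _ _).trans ?_
  rw [fourierBasis.orthonormal.norm_eq_one, one_mul]

theorem hasSum_diskValue (f : L2) {w : ℂ} (hw : ‖w‖ < 1) :
    HasSum (fun n : ℕ => fourierCoeff (f : UnitAddCircle → ℂ) (n : ℤ) * w ^ n) (diskValue f w) := by
  refine Summable.hasSum (Summable.of_norm_bounded
    ((summable_geometric_of_lt_one (norm_nonneg w) hw).mul_left ‖f‖) fun n => ?_)
  rw [norm_mul, norm_pow]
  gcongr
  exact norm_fourierCoeff_le f n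

theorem kernel_mem {θ : L2} (hθ : IsInner θ) {w : ℂ} (hw : ‖w‖ < 1) :
    (memLp_kernelFun θ hw).toLp ∈ K θ := by
  have hθi : Integrable θ haarAddCircle := (Lp.memLp θ).integrable (by norm_num)
  have hθc : Integrable (fun x => conj (θ x)) (haarAddCircle : Measure UnitAddCircle) :=
    (Complex.conjLIE.toContinuousLinearEquiv.toContinuousLinearMap).integrable_comp hθi
  have hf : ∀ (i : ℤ) (F : UnitAddCircle → ℂ), Integrable F haarAddCircle →
      Integrable (fun x => fourier i x * F x) haarAddCircle := fun i F hF =>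
    hF.bdd_mul (c := 1) (by fun_prop) (Eventually.of_forall fun x =>
      (norm_fourier_apply i x).le)
  have hco := (memLp_kernelFun θ hw).coeFn_toLp
  refine ⟨fun n hn => ?_, ?_⟩
  · have h1 : fourierCoeff ((memLp_kernelFun θ hw).toLp : UnitAddCircle → ℂ) n
        = ∫ x, (fourier (-n) x * (1 - conj (diskValue θ w) * θ x))
          / (1 - conj w * fourier 1 x) ∂haarAddCircle := by
      rw [fourierCoeff]
      refine integral_congr_ae ?_
      filter_upwards [hco] with x hx
      rw [hx, kernelFun, smul_eq_mul, mul_div_assoc]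
    have hi : Integrable (fun x => 1 - conj (diskValue θ w) * θ x)
        (haarAddCircle : Measure UnitAddCircle) :=
      (integrable_const _).sub (hθi.const_mul _)
    have h2 := hasSum_integral_div _ (hf (-n) _ hi) hw
    rw [h1]
    refine h2.unique ?_
    convert hasSum_zero using 2 with m
    rw [integral_fourier_mul]
    have : fourierCoeff (fun x => 1 - conj (diskValue θ w) * θ x) (n - m)
        = fourierCoeff (fun _ : UnitAddCircle => (1 : ℂ)) (n - m)
          - conj (diskValue θ w) * fourierCoeff θ (n - m) := by
      simp only [fourierCoeff, smul_eq_mul]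
      rw [← integral_const_mul, ← integral_sub (hf _ _ (integrable_const _))
        ((hf _ _ hθi).const_mul _)]
      congr 1; ext x; ring
    rw [this, fourierCoeff_one, if_neg (by omega), hθ.mem_H2 _ (by omega)]
    simp
  · refine (Submodule.mem_orthogonal _ _).2 ?_
    rintro h ⟨g, hg, e⟩
    have hb : MemLp (fun x => conj (θ x)) ∞ (haarAddCircle : Measure UnitAddCircle) :=
      memLp_top_of_bound hθc.1 1 (by
        filter_upwards [hθ.norm_eq_one] with x hx
        simp [hx])
    have hv : MemLp (fun x => conj (θ x) * kernelFun θ w x) 2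
        (haarAddCircle : Measure UnitAddCircle) := (memLp_kernelFun θ hw).mul' hb
    have hin : ⟪h, (memLp_kernelFun θ hw).toLp⟫_ℂ = ⟪g, hv.toLp⟫_ℂ := by
      rw [MeasureTheory.L2.inner_def, MeasureTheory.L2.inner_def]
      refine integral_congr_ae ?_
      filter_upwards [hco, hv.coeFn_toLp, e] with x h1 h2 h3
      rw [h1, h2, h3]
      simp; ring
    rw [hin]
    refine (fourierBasis.hasSum_inner_mul_inner g hv.toLp).unique ?_
    convert hasSum_zero using 2 with i
    rcases lt_or_ge i 0 with hi | hi
    · rw [← inner_conj_symm, ← fourierBasis.repr_apply_apply g i, fourierBasis_repr, hg i hi]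
      simp
    · rw [← fourierBasis.repr_apply_apply hv.toLp i, fourierBasis_repr]
      obtain ⟨i, rfl⟩ := Int.eq_ofNat_of_zero_le hi
      have h1 : fourierCoeff (hv.toLp : UnitAddCircle → ℂ) (i : ℤ)
          = ∫ x, (fourier (-(i : ℤ)) x * (conj (θ x) - conj (diskValue θ w)))
            / (1 - conj w * fourier 1 x) ∂haarAddCircle := by
        rw [fourierCoeff]
        refine integral_congr_ae ?_
        filter_upwards [hv.coeFn_toLp, hθ.norm_eq_one] with x hx h1
        have h2 : conj (θ x) * θ x = 1 := by
          rw [Complex.conj_mul', h1]; simp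
        rw [hx, kernelFun, smul_eq_mul, mul_div_assoc, ← mul_div_assoc (conj (θ x))]
        congr 2
        linear_combination -conj (diskValue θ w) * h2
      have hi : Integrable (fun x => conj (θ x) - conj (diskValue θ w))
          (haarAddCircle : Measure UnitAddCircle) := hθc.sub (integrable_const _)
      have h2 := hasSum_integral_div _ (hf (-(i : ℤ)) _ hi) hw
      suffices fourierCoeff (hv.toLp : UnitAddCircle → ℂ) (i : ℤ) = 0 by rw [this, mul_zero]
      rw [h1]
      refine h2.unique ?_
      have h3 : ∀ m : ℕ, conj w ^ m * ∫ x, fourier (m : ℤ) x *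
          (fourier (-(i : ℤ)) x * (conj (θ x) - conj (diskValue θ w))) ∂haarAddCircle
          = conj w ^ m * conj (fourierCoeff θ ((m : ℤ) - i))
            - if m = i then conj w ^ i * conj (diskValue θ w) else 0 := by
        intro m
        rw [integral_fourier_mul]
        have : fourierCoeff (fun x => conj (θ x) - conj (diskValue θ w)) ((i : ℤ) - m)
            = fourierCoeff (fun x => conj (θ x)) ((i : ℤ) - m)
              - conj (diskValue θ w)
                * fourierCoeff (fun _ : UnitAddCircle => (1 : ℂ)) ((i : ℤ) - m) := by
          simp only [fourierCoeff, smul_eq_mul]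
          rw [← integral_const_mul, ← integral_sub (hf _ _ hθc)
            ((hf _ _ (integrable_const _)).const_mul _)]
          congr 1; ext x; ring
        rw [this, fourierCoeff_conj, fourierCoeff_one, neg_sub]
        by_cases hm : m = i
        · subst hm; simp; ring
        · rw [if_neg (by omega), if_neg hm]; ring
      have h5 : HasSum (fun m : ℕ => conj w ^ m * conj (fourierCoeff θ ((m : ℤ) - i)))
          (conj w ^ i * conj (diskValue θ w)) := by
        rw [← (add_left_injective i).hasSum_iff]
        · have h4 := ((hasSum_diskValue θ hw).map (starRingEnd ℂ)
            Complex.continuous_conj).mul_left (conj w ^ i)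
          have e4 : (fun m : ℕ => conj w ^ m * conj (fourierCoeff θ ((m : ℤ) - i))) ∘ (· + i)
              = fun n : ℕ => conj w ^ i *
                (starRingEnd ℂ ∘ fun n : ℕ => fourierCoeff θ (n : ℤ) * w ^ n) n := by
            ext n
            simp [pow_add]; ring
          rw [e4]
          exact h4
        · intro m hm
          have : m < i := by
            by_contra hc
            exact hm ⟨m - i, by simp; omega⟩
          rw [hθ.mem_H2 _ (by omega)]
          simp
      have h6 := h5.sub (hasSum_ite_eq i (conj w ^ i * conj (diskValue θ w)))
      rw [sub_self] at h6
      rw [funext h3]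
      exact h6

/-- The reproducing kernel `k_w` of `K_θ` at a point `w` of the open unit disk; outside the disk
the value `0` is a placeholder. -/
def kernel {θ : L2} (hθ : IsInner θ) (w : ℂ) : K θ :=
  if hw : ‖w‖ < 1 then ⟨(memLp_kernelFun θ hw).toLp, kernel_mem hθ hw⟩ else 0

/-- The derivative of order `n` of the map `w ↦ k_w` with respect to `conj w`, in the norm of
`K_θ`, that is the complex derivative of order `n` of `u ↦ k_{conj u}` at `u = conj w`. -/
def dbarKernel {θ : L2} (hθ : IsInner θ) (n : ℕ) (w : ℂ) : K θ :=
  iteratedDeriv n (fun u : ℂ => kernel hθ (conj u)) (conj w)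

/-- The closure in `K_θ` of the range of an operator on `K_θ`. -/
def closureRange {θ : L2} (A : K θ →L[ℂ] K θ) : Submodule ℂ (K θ) :=
  A.range.topologicalClosure

end TruncatedToeplitz

end

open TruncatedToeplitz

noncomputable section

open MeasureTheory AddCircle Filter
open scoped ENNReal ComplexConjugate InnerProductSpace

namespace TruncatedToeplitz

/-! Let N be the orthogonal complement of the range of A. Everything is read off on N. Since k_w is
the sum of conj(w)^n P_θ(z^n), the n-th derivative at 0 is n! P_θ(z^n), and pairing it with f in K_θ
gives n! times the n-th Taylor coefficient of f. Hence the j-th derivative lies in the closed range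
iff the j-th coefficient vanishes on all of N (`dbarKernel_zero_mem_iff`). The integer n is
therefore the least order of vanishing at 0 among the elements of N, and it exists because N ≠ 0.

By duality, the inclusion follows once division by z, which is the adjoint of S_θ on functions
vanishing at 0, maps the elements of N with zero n-th coefficient into N
(`backShift_mem_closureRange_orthogonal`).

The reason is a Hankel-type structure. With the conjugation C f = θ conj(z f), put B(p, q) = ⟪q, A C
p⟫. For bounded p, q this is the integral of φ θ conj(z p q), which depends only on the product pq.
So B is symmetric (`inner_toeplitz_symm`), and a factor z can be moved from one argument to the
other (`inner_toeplitz_shift`); density of the bounded functions removes boundedness. As C is onto,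
f is in N iff B(p, f) = 0 for all p. Let f in N vanish to order greater than n, and let h in N
vanish to order exactly n. If p(0) = 0, then B(p, f/z) = B(p/z, f) = 0. One further p with p(0) ≠ 0
suffices, and p = h/z^n serves: B(h/z^n, f/z) = B(f/z^(n+1), h) = 0. -/

/-- The inner product of `K_θ` inherited from `L²`, preferred to the one of the `C⋆`-module
structure. -/
instance instInnerK (θ : L2) : Inner ℂ (K θ) := InnerProductSpace.toInner

/-! ### Fourier coefficients and the Hardy space -/

theorem inner_fourierLp (f : L2) (n : ℤ) :
    ⟪(fourierLp 2 n : L2), f⟫_ℂ = fourierCoeff (f : UnitAddCircle → ℂ) n := by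
  rw [← fourierBasis_repr, fourierBasis.repr_apply_apply, coe_fourierBasis]

theorem inner_eq_zero_of_fourierCoeff {f g : L2}
    (h : ∀ i : ℤ, fourierCoeff (f : UnitAddCircle → ℂ) i = 0 ∨
      fourierCoeff (g : UnitAddCircle → ℂ) i = 0) : ⟪f, g⟫_ℂ = 0 := by
  refine (fourierBasis.hasSum_inner_mul_inner f g).unique ?_
  convert hasSum_zero using 2 with i
  rw [coe_fourierBasis, ← inner_conj_symm f, inner_fourierLp, inner_fourierLp]
  rcases h i with h | h <;> simp [h]

theorem fourierLp_mem_H2 (n : ℕ) : (fourierLp 2 (n : ℤ) : L2) ∈ H2 := fun m hm => by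
  rw [fourierCoeff_congr_ae (coeFn_fourierLp 2 (n : ℤ)), fourierCoeff_fourier, Pi.single_apply,
    if_neg (by omega)]

theorem conj_mul_self_fourier (x : UnitAddCircle) :
    conj (fourier 1 x : ℂ) * fourier 1 x = 1 := by
  rw [Complex.conj_mul', norm_fourier_apply]; simp

/-- Multiplication by `zⁿ` on `L²`. -/
def mulFourier (n : ℤ) : L2 →L[ℂ] L2 :=
  (ContinuousLinearMap.mul ℂ ℂ).holderL haarAddCircle ∞ 2 2 (fourierLp ∞ n)

theorem coeFn_mulFourier (n : ℤ) (f : L2) :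
    mulFourier n f =ᵐ[haarAddCircle] fun x => fourier n x * f x := by
  have h := (ContinuousLinearMap.mul ℂ ℂ).coeFn_holder (r := 2) (fourierLp ∞ n) f
  filter_upwards [h, coeFn_fourierLp ∞ n] with x h1 h2
  rw [← h2]
  exact h1

theorem fourierCoeff_mulFourier (n m : ℤ) (f : L2) :
    fourierCoeff (mulFourier n f : UnitAddCircle → ℂ) m
      = fourierCoeff (f : UnitAddCircle → ℂ) (m - n) := by
  rw [← integral_fourier_mul, fourierCoeff]
  refine integral_congr_ae ?_
  filter_upwards [coeFn_mulFourier n f] with x hx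
  rw [hx, smul_eq_mul]; ring

theorem inner_mulFourier_left (n : ℤ) (f g : L2) :
    ⟪mulFourier n f, g⟫_ℂ = ⟪f, mulFourier (-n) g⟫_ℂ := by
  rw [MeasureTheory.L2.inner_def, MeasureTheory.L2.inner_def]
  refine integral_congr_ae ?_
  filter_upwards [coeFn_mulFourier n f, coeFn_mulFourier (-n) g] with x h1 h2
  rw [h1, h2]
  simp; ring

theorem mulFourier_one_mem_H2 {f : L2} (hf : f ∈ H2) : mulFourier 1 f ∈ H2 := fun n hn => by
  rw [fourierCoeff_mulFourier, hf _ (by omega)]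

theorem memLp_top_mulFourier (n : ℤ) {f : L2} (hf : MemLp f ∞ haarAddCircle) :
    MemLp (mulFourier n f : L2) ∞ haarAddCircle := by
  refine hf.congr_norm (Lp.aestronglyMeasurable _) ?_
  filter_upwards [coeFn_mulFourier n f] with x hx
  rw [hx, norm_mul, norm_fourier_apply, one_mul]

theorem memLp_top_of_isInner {θ : L2} (hθ : IsInner θ) : MemLp θ ∞ haarAddCircle :=
  memLp_top_of_bound (Lp.aestronglyMeasurable _) 1 (by
    filter_upwards [hθ.norm_eq_one] with x hx using hx.le)

theorem conj_mul_self_of_norm_eq_one {z : ℂ} (hz : ‖z‖ = 1) : conj z * z = 1 := by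
  rw [Complex.conj_mul', hz]; simp

/-! ### The model space -/

theorem inner_P (θ : L2) (u : K θ) (v : L2) : ⟪u, P θ v⟫_ℂ = ⟪(u : L2), v⟫_ℂ :=
  Submodule.inner_orthogonalProjectionOnto_eq_of_mem_left u v

theorem inner_P_left (θ : L2) (u : K θ) (v : L2) : ⟪P θ v, u⟫_ℂ = ⟪v, (u : L2)⟫_ℂ :=
  Submodule.inner_orthogonalProjectionOnto_eq_of_mem_right u v

theorem P_coe (θ : L2) (u : K θ) : P θ u = u :=
  Submodule.orthogonalProjectionOnto_mem_subspace_eq_self u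

theorem P_eq_zero_of_mem_thetaH2 {θ v : L2} (hv : v ∈ thetaH2 θ) : P θ v = 0 := by
  refine Submodule.orthogonalProjectionOnto_apply_of_mem_orthogonal ?_
  exact (Submodule.mem_orthogonal' _ _).2 fun u hu => (Submodule.mem_orthogonal _ _).1 hu.2 v hv

/-- The projection of `zⁿ` to `K_θ`. -/
def projMonomial (θ : L2) (n : ℕ) : K θ := P θ (fourierLp 2 (n : ℤ))

theorem inner_projMonomial (θ : L2) (n : ℕ) (f : K θ) :
    ⟪projMonomial θ n, f⟫_ℂ = fourierCoeff ((f : L2) : UnitAddCircle → ℂ) n := by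
  rw [projMonomial, inner_P_left, inner_fourierLp]

theorem eq_zero_of_inner_projMonomial {θ : L2} {f : K θ}
    (h : ∀ n, ⟪projMonomial θ n, f⟫_ℂ = 0) : f = 0 := by
  rw [← Submodule.coe_eq_zero, ← inner_self_eq_zero (𝕜 := ℂ)]
  refine inner_eq_zero_of_fourierCoeff fun i => Or.inl ?_
  rcases lt_or_ge i 0 with hi | hi
  · exact f.2.1 i hi
  · obtain ⟨i, rfl⟩ := Int.eq_ofNat_of_zero_le hi
    have := h i
    rwa [inner_projMonomial] at this

/-- The backward shift `f ↦ P_θ (z⁻¹ f)` on `K_θ`. -/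
def backShift (θ : L2) : K θ →L[ℂ] K θ := P θ ∘L mulFourier (-1) ∘L (K θ).subtypeL

/-- This identifies the adjoint of S_θ, through which shift invariance of the closed range becomes a
statement about its orthogonal complement. -/
theorem inner_S (θ : L2) (f g : K θ) : ⟪g, S θ f⟫_ℂ = ⟪backShift θ g, f⟫_ℂ := by
  have h1 : S θ f = P θ (mulFourier 1 f) := rfl
  have h2 : backShift θ g = P θ (mulFourier (-1) g) := rfl
  rw [h1, h2, inner_P, inner_P_left, inner_mulFourier_left, neg_neg]

/-- Dividing by z loses nothing when the constant term is zero, and ⟪θ g, f/z⟫ = ⟪θ z g, f⟫ = 0.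
Thus the projection in `backShift` is superfluous on such f. -/
theorem mulFourier_neg_one_mem_K {θ : L2} {f : K θ}
    (hf : fourierCoeff ((f : L2) : UnitAddCircle → ℂ) 0 = 0) :
    mulFourier (-1) (f : L2) ∈ K θ := by
  refine ⟨fun n hn => ?_, (Submodule.mem_orthogonal _ _).2 ?_⟩
  · rw [fourierCoeff_mulFourier]
    rcases eq_or_ne n (-1) with rfl | h
    · simpa using hf
    · exact f.2.1 _ (by omega)
  · rintro h ⟨g, hg, e⟩
    rw [← inner_mulFourier_left]
    refine (Submodule.mem_orthogonal _ _).1 f.2.2 _ ⟨mulFourier 1 g, mulFourier_one_mem_H2 hg, ?_⟩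
    filter_upwards [e, coeFn_mulFourier 1 h, coeFn_mulFourier 1 g] with x h1 h2 h3
    rw [h2, h3, h1]; ring

theorem coe_backShift {θ : L2} {f : K θ}
    (hf : fourierCoeff ((f : L2) : UnitAddCircle → ℂ) 0 = 0) :
    (backShift θ f : L2) = mulFourier (-1) (f : L2) :=
  congrArg Subtype.val (P_coe θ ⟨_, mulFourier_neg_one_mem_K hf⟩)

theorem fourierCoeff_backShift {θ : L2} {f : K θ}
    (hf : fourierCoeff ((f : L2) : UnitAddCircle → ℂ) 0 = 0) (n : ℤ) :
    fourierCoeff ((backShift θ f : L2) : UnitAddCircle → ℂ) n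
      = fourierCoeff ((f : L2) : UnitAddCircle → ℂ) (n + 1) := by
  rw [coe_backShift hf, fourierCoeff_mulFourier, sub_neg_eq_add]

/-! ### The conjugation of the model space -/

theorem memLp_modelConj {θ : L2} (hθ : IsInner θ) (f : L2) :
    MemLp (fun x => θ x * conj (fourier 1 x * f x)) 2
      (haarAddCircle : Measure UnitAddCircle) := by
  refine (Lp.memLp f).congr_norm ?_ ?_
  · exact (Lp.aestronglyMeasurable θ).mul (Complex.continuous_conj.comp_aestronglyMeasurable
      ((fourier (T := 1) 1).continuous.aestronglyMeasurable.mul (Lp.aestronglyMeasurable f)))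
  · filter_upwards [hθ.norm_eq_one] with x hx
    rw [norm_mul, hx, RCLike.norm_conj, norm_mul, norm_fourier_apply]; simp

/-- The two conditions defining K_θ are exchanged. The coefficient of C f at -m-1 is the conjugate
of ⟪θ z^m, f⟫, which vanishes as f ⊥ θH². Conversely ⟪θ g, C f⟫ = ⟪g, conj(z f)⟫ vanishes, since f
in H² leaves conj(z f) only negative frequencies. -/
theorem modelConj_mem {θ : L2} (hθ : IsInner θ) (f : K θ) :
    (memLp_modelConj hθ f).toLp ∈ K θ := by
  have hco := (memLp_modelConj hθ f).coeFn_toLp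
  refine ⟨fun n hn => ?_, (Submodule.mem_orthogonal _ _).2 ?_⟩
  · obtain ⟨m, rfl⟩ : ∃ m : ℕ, n = -(m : ℤ) - 1 := ⟨(-n - 1).toNat, by omega⟩
    have hb : MemLp (fun x => θ x * fourier (m : ℤ) x) 2
        (haarAddCircle : Measure UnitAddCircle) := by
      refine (Lp.memLp θ).congr_norm ((Lp.aestronglyMeasurable θ).mul
        (fourier (T := 1) (m : ℤ)).continuous.aestronglyMeasurable) (ae_of_all _ fun x => ?_)
      rw [norm_mul, norm_fourier_apply, mul_one]
    have h0 : ⟪hb.toLp, (f : L2)⟫_ℂ = 0 :=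
      (Submodule.mem_orthogonal _ _).1 f.2.2 _ ⟨fourierLp 2 (m : ℤ), fourierLp_mem_H2 m, by
        filter_upwards [hb.coeFn_toLp, coeFn_fourierLp 2 (m : ℤ)] with x h1 h2
        rw [h1, h2]⟩
    rw [← inner_conj_symm, map_eq_zero] at h0
    rw [← h0, MeasureTheory.L2.inner_def, fourierCoeff]
    refine integral_congr_ae ?_
    filter_upwards [hco, hb.coeFn_toLp] with x h1 h2
    rw [h1, h2, neg_sub, sub_neg_eq_add, add_comm, fourier_add]
    have := conj_mul_self_fourier x
    simp only [map_mul, smul_eq_mul, RCLike.inner_apply]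
    linear_combination (fourier (m : ℤ) x * θ x * conj ((f : L2) x)) * this
  · rintro h ⟨g, hg, e⟩
    have hb : MemLp (fun x => conj (fourier 1 x * (f : L2) x)) 2
        (haarAddCircle : Measure UnitAddCircle) := by
      refine (Lp.memLp (f : L2)).congr_norm (Complex.continuous_conj.comp_aestronglyMeasurable
        ((fourier (T := 1) 1).continuous.aestronglyMeasurable.mul (Lp.aestronglyMeasurable _)))
        (ae_of_all _ fun x => ?_)
      rw [RCLike.norm_conj, norm_mul, norm_fourier_apply, one_mul]
    have h1 : ⟪h, (memLp_modelConj hθ f).toLp⟫_ℂ = ⟪g, hb.toLp⟫_ℂ := by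
      rw [MeasureTheory.L2.inner_def, MeasureTheory.L2.inner_def]
      refine integral_congr_ae ?_
      filter_upwards [hco, hb.coeFn_toLp, e, hθ.norm_eq_one] with x h1 h2 h3 h4
      rw [h1, h2, h3]
      have := conj_mul_self_of_norm_eq_one h4
      simp only [map_mul, RCLike.inner_apply]
      linear_combination (conj (fourier 1 x) * conj ((f : L2) x) * conj (g x)) * this
    rw [h1]
    refine inner_eq_zero_of_fourierCoeff fun i => ?_
    rcases lt_or_ge i 0 with hi | hi
    · exact Or.inl (hg i hi)
    · right
      rw [fourierCoeff_congr_ae hb.coeFn_toLp, fourierCoeff_conj,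
        ← fourierCoeff_congr_ae (coeFn_mulFourier 1 (f : L2)), fourierCoeff_mulFourier,
        f.2.1 _ (by omega), map_zero]

/-- The conjugation `f ↦ θ conj (z f)` of `K_θ`. -/
def modelConj {θ : L2} (hθ : IsInner θ) (f : K θ) : K θ :=
  ⟨(memLp_modelConj hθ f).toLp, modelConj_mem hθ f⟩

theorem coeFn_modelConj {θ : L2} (hθ : IsInner θ) (f : K θ) :
    (modelConj hθ f : L2) =ᵐ[haarAddCircle] fun x => θ x * conj (fourier 1 x * (f : L2) x) :=
  (memLp_modelConj hθ f).coeFn_toLp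

theorem modelConj_sub {θ : L2} (hθ : IsInner θ) (f g : K θ) :
    modelConj hθ (f - g) = modelConj hθ f - modelConj hθ g := by
  refine Subtype.ext (Lp.ext ?_)
  filter_upwards [coeFn_modelConj hθ (f - g), coeFn_modelConj hθ f, coeFn_modelConj hθ g,
    Lp.coeFn_sub (f : L2) g, Lp.coeFn_sub (modelConj hθ f : L2) (modelConj hθ g)]
    with x h1 h2 h3 h4 h5
  rw [h1, Submodule.coe_sub, Submodule.coe_sub, h4, h5, Pi.sub_apply, Pi.sub_apply, h2, h3]
  simp; ring

theorem modelConj_smul {θ : L2} (hθ : IsInner θ) (c : ℂ) (f : K θ) :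
    modelConj hθ (c • f) = conj c • modelConj hθ f := by
  refine Subtype.ext (Lp.ext ?_)
  filter_upwards [coeFn_modelConj hθ (c • f), coeFn_modelConj hθ f,
    Lp.coeFn_smul c (f : L2), Lp.coeFn_smul (conj c) (modelConj hθ f : L2)] with x h1 h2 h3 h4
  rw [h1, Submodule.coe_smul, Submodule.coe_smul, h3, h4, Pi.smul_apply, Pi.smul_apply, h2]
  simp; ring

theorem norm_modelConj {θ : L2} (hθ : IsInner θ) (f : K θ) : ‖modelConj hθ f‖ = ‖f‖ := by
  rw [Submodule.coe_norm, Submodule.coe_norm, Lp.norm_def, Lp.norm_def]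
  congr 1
  refine eLpNorm_congr_norm_ae ?_
  filter_upwards [coeFn_modelConj hθ f, hθ.norm_eq_one] with x h1 h2
  rw [h1, norm_mul, h2, RCLike.norm_conj, norm_mul, norm_fourier_apply]; simp

theorem continuous_modelConj {θ : L2} (hθ : IsInner θ) : Continuous (modelConj hθ) :=
  (Isometry.of_dist_eq fun f g => by
    rw [dist_eq_norm, dist_eq_norm, ← modelConj_sub, norm_modelConj]).continuous

theorem modelConj_modelConj {θ : L2} (hθ : IsInner θ) (f : K θ) :
    modelConj hθ (modelConj hθ f) = f := by
  refine Subtype.ext (Lp.ext ?_)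
  filter_upwards [coeFn_modelConj hθ (modelConj hθ f), coeFn_modelConj hθ f,
    hθ.norm_eq_one] with x h1 h2 h3
  rw [h1, h2]
  have e1 := conj_mul_self_of_norm_eq_one h3
  have e2 := conj_mul_self_fourier x
  simp only [map_mul, Complex.conj_conj]
  linear_combination ((f : L2) x * conj (fourier 1 x) * fourier 1 x) * e1 + (f : L2) x * e2

theorem memLp_top_modelConj {θ : L2} (hθ : IsInner θ) {f : K θ}
    (hf : MemLp (f : L2) ∞ haarAddCircle) : MemLp (modelConj hθ f : L2) ∞ haarAddCircle := by
  refine hf.congr_norm (Lp.aestronglyMeasurable _) ?_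
  filter_upwards [coeFn_modelConj hθ f, hθ.norm_eq_one] with x h1 h2
  rw [h1, norm_mul, h2, RCLike.norm_conj, norm_mul, norm_fourier_apply]; simp

/-! ### Power series expansion of the reproducing kernels -/

/-- The function `1 / (1 - conj w z)` as an element of `L²`. -/
def szego {w : ℂ} (hw : ‖w‖ < 1) : L2 :=
  ContinuousMap.toLp 2 haarAddCircle ℂ ⟨_, continuous_inv_kernel hw⟩

theorem coeFn_szego {w : ℂ} (hw : ‖w‖ < 1) :
    szego hw =ᵐ[haarAddCircle] fun x => (1 - conj w * fourier 1 x)⁻¹ :=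
  ContinuousMap.coeFn_toLp haarAddCircle _

/-- The geometric series converges uniformly on the circle, hence in L². -/
theorem hasSum_szego {w : ℂ} (hw : ‖w‖ < 1) :
    HasSum (fun n : ℕ => conj w ^ n • (fourierLp 2 (n : ℤ) : L2)) (szego hw) := by
  have hs : Summable fun n : ℕ => conj w ^ n • (fourier (n : ℤ) : C(UnitAddCircle, ℂ)) := by
    refine Summable.of_norm_bounded (summable_geometric_of_lt_one (norm_nonneg w) hw) fun n => ?_
    rw [norm_smul, fourier_norm, norm_pow, RCLike.norm_conj, mul_one]
  have hsum : HasSum (fun n : ℕ => conj w ^ n • (fourier (n : ℤ) : C(UnitAddCircle, ℂ)))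
      ⟨_, continuous_inv_kernel hw⟩ := by
    convert hs.hasSum using 1
    ext x
    refine (hasSum_geometric_of_norm_lt_one (norm_conj_mul_fourier_lt hw x)).unique ?_
    have e : (fun n : ℕ => (conj w * fourier 1 x) ^ n)
        = fun n : ℕ => (conj w ^ n • (fourier (n : ℤ) : C(UnitAddCircle, ℂ))) x := by
      ext n
      have : (fourier (n : ℤ) x : ℂ) = (fourier 1 x) ^ n := by
        simp [fourier_apply, toCircle_nsmul]
      rw [ContinuousMap.smul_apply, this, mul_pow, smul_eq_mul]
    rw [e]
    exact ContinuousMap.hasSum_apply hs.hasSum x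
  have := (ContinuousMap.toLp (E := ℂ) 2 haarAddCircle ℂ).hasSum hsum
  simp only [map_smul] at this
  exact this

theorem szego_mem_H2 {w : ℂ} (hw : ‖w‖ < 1) : szego hw ∈ H2 :=
  isClosed_H2.mem_of_tendsto (hasSum_szego hw) (Eventually.of_forall fun _ =>
    H2.sum_mem fun n _ => H2.smul_mem _ (fourierLp_mem_H2 n))

/-- The kernel differs from 1/(1 - conj(w) z) by a multiple of θ/(1 - conj(w) z), which lies in θH²
and is annihilated by P_θ. -/
theorem kernel_eq_P_szego {θ : L2} (hθ : IsInner θ) {w : ℂ} (hw : ‖w‖ < 1) :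
    kernel hθ w = P θ (szego hw) := by
  have hb : MemLp (fun x => θ x * szego hw x) 2 (haarAddCircle : Measure UnitAddCircle) :=
    (Lp.memLp (szego hw)).mul' (memLp_top_of_isInner hθ)
  have h0 : P θ hb.toLp = 0 := P_eq_zero_of_mem_thetaH2 ⟨szego hw, szego_mem_H2 hw, hb.coeFn_toLp⟩
  have hk : (kernel hθ w : L2) = szego hw - conj (diskValue θ w) • hb.toLp := by
    rw [kernel, dif_pos hw]
    refine Lp.ext ?_
    filter_upwards [(memLp_kernelFun θ hw).coeFn_toLp, Lp.coeFn_sub (szego hw)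
      (conj (diskValue θ w) • hb.toLp), Lp.coeFn_smul (conj (diskValue θ w)) hb.toLp,
      hb.coeFn_toLp, coeFn_szego hw] with x h1 h2 h3 h4 h5
    rw [h1, h2, Pi.sub_apply, h3, Pi.smul_apply, h4, h5, kernelFun, smul_eq_mul]
    ring
  rw [← P_coe θ (kernel hθ w), hk, map_sub, map_smul, h0, smul_zero, sub_zero]

theorem hasSum_kernel {θ : L2} (hθ : IsInner θ) {w : ℂ} (hw : ‖w‖ < 1) :
    HasSum (fun n : ℕ => conj w ^ n • projMonomial θ n) (kernel hθ w) := by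
  rw [kernel_eq_P_szego hθ hw]
  simpa only [map_smul, Function.comp_def, projMonomial] using (P θ).hasSum (hasSum_szego hw)

/-- The Taylor series at the origin of `u ↦ k_{conj u}`. -/
def kernelSeries (θ : L2) : FormalMultilinearSeries ℂ ℂ (K θ) := fun n =>
  ContinuousMultilinearMap.mkPiRing ℂ (Fin n) (projMonomial θ n)

theorem coeff_kernelSeries (θ : L2) (n : ℕ) : (kernelSeries θ).coeff n = projMonomial θ n := by
  simp [kernelSeries, FormalMultilinearSeries.coeff]

theorem hasFPowerSeriesAt_kernel {θ : L2} (hθ : IsInner θ) :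
    HasFPowerSeriesAt (fun u : ℂ => kernel hθ (conj u)) (kernelSeries θ) 0 := by
  rw [hasFPowerSeriesAt_iff]
  filter_upwards [Metric.ball_mem_nhds (0 : ℂ) one_pos] with u hu
  have hu' : ‖conj u‖ < 1 := by simpa using hu
  simpa only [coeff_kernelSeries, Complex.conj_conj, zero_add] using hasSum_kernel hθ hu'

theorem dbarKernel_zero_eq {θ : L2} (hθ : IsInner θ) (n : ℕ) :
    dbarKernel hθ n 0 = (n.factorial : ℂ) • projMonomial θ n := by
  obtain ⟨r, hr⟩ := hasFPowerSeriesAt_kernel hθ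
  have h := hr.factorial_smul 1 n
  rw [dbarKernel, map_zero, iteratedDeriv_eq_iteratedFDeriv, ← coeff_kernelSeries,
    Nat.cast_smul_eq_nsmul]
  exact h.symm

theorem kernel_zero_eq {θ : L2} (hθ : IsInner θ) : kernel hθ 0 = projMonomial θ 0 := by
  have := dbarKernel_zero_eq hθ 0
  simpa [dbarKernel] using this

theorem memLp_top_kernel {θ : L2} (hθ : IsInner θ) (w : ℂ) :
    MemLp (kernel hθ w : L2) ∞ haarAddCircle := by
  by_cases hw : ‖w‖ < 1
  · rw [kernel, dif_pos hw]
    refine MemLp.ae_eq (memLp_kernelFun θ hw).coeFn_toLp.symm ?_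
    have h1 : MemLp (fun x : UnitAddCircle => (1 - conj w * fourier 1 x)⁻¹) ∞ haarAddCircle :=
      BoundedContinuousFunction.memLp_top
        (BoundedContinuousFunction.mkOfCompact ⟨_, continuous_inv_kernel hw⟩)
    have h2 : MemLp (fun x => 1 - conj (diskValue θ w) * θ x) ∞
        (haarAddCircle : Measure UnitAddCircle) :=
      (memLp_const 1).sub ((memLp_top_of_isInner hθ).const_mul _)
    exact h1.mul' h2
  · rw [kernel, dif_neg hw]
    exact MemLp.ae_eq (Lp.coeFn_zero ℂ 2 haarAddCircle).symm MemLp.zero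

/-- The subspace `K_θ ∩ L^∞` of `K_θ`. -/
def boundedPart (θ : L2) : Submodule ℂ (K θ) where
  carrier := {f | MemLp (f : L2) ∞ haarAddCircle}
  zero_mem' := MemLp.ae_eq (Lp.coeFn_zero ℂ 2 haarAddCircle).symm MemLp.zero
  add_mem' {f g} hf hg := MemLp.ae_eq (Lp.coeFn_add (f : L2) g).symm (MemLp.add hf hg)
  smul_mem' c f hf := MemLp.ae_eq (Lp.coeFn_smul c (f : L2)).symm (MemLp.const_smul hf c)

/-- The kernels are bounded. A function orthogonal to all of them gives a power series that vanishes
identically, so all its Taylor coefficients are zero. -/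
theorem dense_boundedPart {θ : L2} (hθ : IsInner θ) : Dense (boundedPart θ : Set (K θ)) := by
  rw [Submodule.dense_iff_topologicalClosure_eq_top, Submodule.topologicalClosure_eq_top_iff,
    Submodule.eq_bot_iff]
  intro f hf
  have hk : ∀ u : ℂ, ⟪f, kernel hθ (conj u)⟫_ℂ = 0 := fun u =>
    (Submodule.mem_orthogonal' _ _).1 hf _ (memLp_top_kernel hθ _)
  obtain ⟨r, hr⟩ := hasFPowerSeriesAt_kernel hθ
  have hp := ((innerSL ℂ f).comp_hasFPowerSeriesOnBall hr).hasFPowerSeriesAt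
  have hz : (innerSL ℂ f ∘ fun u : ℂ => kernel hθ (conj u)) = 0 := funext hk
  have h0 := HasFPowerSeriesAt.eq_zero (hz ▸ hp)
  refine eq_zero_of_inner_projMonomial fun n => ?_
  have h1 := congrArg (fun p => p.coeff n) h0
  have h2 : ⟪f, projMonomial θ n⟫_ℂ = 0 := by
    simpa [FormalMultilinearSeries.coeff, kernelSeries] using h1
  exact inner_eq_zero_symm.1 h2

theorem inner_K_smul_right {θ : L2} (f g : K θ) (c : ℂ) : ⟪f, c • g⟫_ℂ = c * ⟪f, g⟫_ℂ :=
  inner_smul_right f g c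

theorem inner_K_smul_left {θ : L2} (f g : K θ) (c : ℂ) : ⟪c • f, g⟫_ℂ = conj c * ⟪f, g⟫_ℂ :=
  inner_smul_left f g c

/-! ### Symmetry and shift invariance of truncated Toeplitz operators -/

theorem inner_toeplitz {θ φ : L2} {A : K θ →L[ℂ] K θ}
    (hφ : ∀ (f : K θ) (hf : MemLp (f : L2) ∞ haarAddCircle), A f =
      P θ ((hf.mul' (Lp.memLp φ) : MemLp (fun x => φ x * (f : L2) x) 2 haarAddCircle).toLp))
    {f : K θ} (hf : MemLp (f : L2) ∞ haarAddCircle) (g : K θ) :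
    ⟪g, A f⟫_ℂ = ∫ x, φ x * (f : L2) x * conj ((g : L2) x) ∂haarAddCircle := by
  rw [hφ f hf, inner_P, MeasureTheory.L2.inner_def]
  refine integral_congr_ae ?_
  filter_upwards [(hf.mul' (Lp.memLp φ) :
    MemLp (fun x => φ x * (f : L2) x) 2 haarAddCircle).coeFn_toLp] with x hx
  rw [hx, RCLike.inner_apply]

theorem inner_toeplitz_symm {θ : L2} (hθ : IsInner θ) {A : K θ →L[ℂ] K θ}
    (hA : IsTruncatedToeplitz θ A) (f g : K θ) :
    ⟪g, A f⟫_ℂ = ⟪modelConj hθ f, A (modelConj hθ g)⟫_ℂ := by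
  obtain ⟨φ, hφ⟩ := hA
  have hC := continuous_modelConj hθ
  have hb : ∀ f ∈ boundedPart θ, ∀ g ∈ boundedPart θ,
      ⟪g, A f⟫_ℂ = ⟪modelConj hθ f, A (modelConj hθ g)⟫_ℂ := by
    intro f hf g hg
    rw [inner_toeplitz hφ hf, inner_toeplitz hφ (memLp_top_modelConj hθ hg)]
    refine integral_congr_ae ?_
    filter_upwards [coeFn_modelConj hθ f, coeFn_modelConj hθ g, hθ.norm_eq_one] with x h1 h2 h3
    rw [h1, h2]
    have e1 := conj_mul_self_of_norm_eq_one h3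
    have e2 := conj_mul_self_fourier x
    simp only [map_mul, Complex.conj_conj]
    linear_combination (-(φ x * (f : L2) x * conj ((g : L2) x))) * e1
      - (φ x * (f : L2) x * conj ((g : L2) x) * (conj (θ x) * θ x)) * e2
  have h1 : ∀ f ∈ boundedPart θ, ∀ g,
      ⟪g, A f⟫_ℂ = ⟪modelConj hθ f, A (modelConj hθ g)⟫_ℂ := fun f hf => congrFun
    (Continuous.ext_on (dense_boundedPart hθ) (by fun_prop) (by fun_prop) (hb f hf))
  exact congrFun (Continuous.ext_on (dense_boundedPart hθ) (f := fun f => ⟪g, A f⟫_ℂ)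
    (g := fun f => ⟪modelConj hθ f, A (modelConj hθ g)⟫_ℂ) (by fun_prop) (by fun_prop)
    fun f hf => h1 f hf g) f

/-- Subtraction of the component along the kernel at the origin, which makes a function of `K_θ`
vanish at the origin. -/
def removeValueZero {θ : L2} (hθ : IsInner θ) (f : K θ) : K θ :=
  f - (⟪kernel hθ 0, f⟫_ℂ / ⟪kernel hθ 0, kernel hθ 0⟫_ℂ) • kernel hθ 0

theorem continuous_removeValueZero {θ : L2} (hθ : IsInner θ) :
    Continuous (removeValueZero hθ) := by
  unfold removeValueZero
  fun_prop

theorem inner_kernel_zero {θ : L2} (hθ : IsInner θ) (f : K θ) :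
    ⟪kernel hθ 0, f⟫_ℂ = fourierCoeff ((f : L2) : UnitAddCircle → ℂ) 0 := by
  rw [kernel_zero_eq, inner_projMonomial, Nat.cast_zero]

theorem fourierCoeff_removeValueZero {θ : L2} (hθ : IsInner θ) (f : K θ) :
    fourierCoeff ((removeValueZero hθ f : L2) : UnitAddCircle → ℂ) 0 = 0 := by
  rw [← inner_kernel_zero hθ, removeValueZero, inner_sub_right, inner_K_smul_right]
  -- If k_0 = 0, the quotient defaults to 0, but then every f in K_θ already has zero constant term.
  rcases eq_or_ne (kernel hθ 0) 0 with h | h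
  · simp [h]
  · rw [div_mul_cancel₀ _ (inner_self_ne_zero.2 h), sub_self]

theorem removeValueZero_eq_self {θ : L2} (hθ : IsInner θ) {f : K θ}
    (hf : fourierCoeff ((f : L2) : UnitAddCircle → ℂ) 0 = 0) : removeValueZero hθ f = f := by
  rw [removeValueZero, inner_kernel_zero, hf]; simp

theorem memLp_top_removeValueZero {θ : L2} (hθ : IsInner θ) {f : K θ}
    (hf : f ∈ boundedPart θ) : removeValueZero hθ f ∈ boundedPart θ :=
  (boundedPart θ).sub_mem hf ((boundedPart θ).smul_mem _ (memLp_top_kernel hθ 0))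

/-- Both sides integrate φ θ conj(z · pq/z). Precomposing with `removeValueZero`, which is
continuous and preserves boundedness because k_0 is bounded, lets p and q range over all of K_θ in
the density argument. -/
theorem inner_toeplitz_shift {θ : L2} (hθ : IsInner θ) {A : K θ →L[ℂ] K θ}
    (hA : IsTruncatedToeplitz θ A) {p q : K θ}
    (hp : fourierCoeff ((p : L2) : UnitAddCircle → ℂ) 0 = 0)
    (hq : fourierCoeff ((q : L2) : UnitAddCircle → ℂ) 0 = 0) :
    ⟪backShift θ q, A (modelConj hθ p)⟫_ℂ = ⟪q, A (modelConj hθ (backShift θ p))⟫_ℂ := by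
  obtain ⟨φ, hφ⟩ := hA
  have hC := continuous_modelConj hθ
  have hQ := continuous_removeValueZero hθ
  have hb : ∀ p ∈ boundedPart θ, ∀ q ∈ boundedPart θ,
      ⟪backShift θ (removeValueZero hθ q), A (modelConj hθ (removeValueZero hθ p))⟫_ℂ
        = ⟪removeValueZero hθ q, A (modelConj hθ (backShift θ (removeValueZero hθ p)))⟫_ℂ := by
    intro p hp q hq
    have hp' := memLp_top_removeValueZero hθ hp
    have cp := coe_backShift (fourierCoeff_removeValueZero hθ p)
    have cq := coe_backShift (fourierCoeff_removeValueZero hθ q)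
    have hsp : MemLp (backShift θ (removeValueZero hθ p) : L2) ∞ haarAddCircle := by
      rw [cp]; exact memLp_top_mulFourier _ hp'
    rw [inner_toeplitz hφ (memLp_top_modelConj hθ hp'),
      inner_toeplitz hφ (memLp_top_modelConj hθ hsp)]
    refine integral_congr_ae ?_
    filter_upwards [coeFn_modelConj hθ (removeValueZero hθ p),
      coeFn_modelConj hθ (backShift θ (removeValueZero hθ p)),
      coeFn_mulFourier (-1) (removeValueZero hθ p : L2),
      coeFn_mulFourier (-1) (removeValueZero hθ q : L2)] with x h1 h2 h3 h4
    rw [h1, h2, cp, cq, h3, h4]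
    simp only [map_mul]
    ring
  have h1 : ∀ p ∈ boundedPart θ, ∀ q,
      ⟪backShift θ (removeValueZero hθ q), A (modelConj hθ (removeValueZero hθ p))⟫_ℂ
        = ⟪removeValueZero hθ q, A (modelConj hθ (backShift θ (removeValueZero hθ p)))⟫_ℂ :=
    fun p hp => congrFun
      (Continuous.ext_on (dense_boundedPart hθ) (by fun_prop) (by fun_prop) (hb p hp))
  have h2 := congrFun (Continuous.ext_on (dense_boundedPart hθ)
    (f := fun p => ⟪backShift θ (removeValueZero hθ q),
      A (modelConj hθ (removeValueZero hθ p))⟫_ℂ)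
    (g := fun p => ⟪removeValueZero hθ q,
      A (modelConj hθ (backShift θ (removeValueZero hθ p)))⟫_ℂ) (by fun_prop) (by fun_prop)
    fun p hp => h1 p hp q) p
  simpa only [removeValueZero_eq_self hθ hp, removeValueZero_eq_self hθ hq] using h2

/-! ### The orthogonal complement of the range -/

theorem mem_closureRange_orthogonal {θ : L2} {A : K θ →L[ℂ] K θ} {g : K θ} :
    g ∈ (closureRange A)ᗮ ↔ ∀ f, ⟪g, A f⟫_ℂ = 0 := by
  rw [closureRange, Submodule.orthogonal_closure, Submodule.mem_orthogonal']
  exact ⟨fun h f => h _ ⟨f, rfl⟩, by rintro h _ ⟨f, rfl⟩; exact h f⟩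

theorem fourierCoeff_backShift_iterate {θ : L2} {f : K θ} {n : ℕ}
    (hf : ∀ j : ℕ, j < n → fourierCoeff ((f : L2) : UnitAddCircle → ℂ) j = 0) (m : ℤ) :
    fourierCoeff (((backShift θ)^[n] f : K θ) : L2) m
      = fourierCoeff ((f : L2) : UnitAddCircle → ℂ) (m + n) := by
  induction n generalizing m with
  | zero => simp
  | succ n ih =>
    have ih' := ih fun j hj => hf j (by omega)
    rw [Function.iterate_succ_apply', fourierCoeff_backShift, ih']
    · congr 1; push_cast; ring
    · rw [ih', zero_add, hf n (by omega)]

/-- If `h` has a zero of order exactly `n` at the origin and `f` one of order greater than `n`,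
both orthogonal to the range, then `f / z` is orthogonal to the range as well. -/
theorem backShift_mem_closureRange_orthogonal {θ : L2} (hθ : IsInner θ) {A : K θ →L[ℂ] K θ}
    (hA : IsTruncatedToeplitz θ A) {n : ℕ} {f h : K θ} (hf : f ∈ (closureRange A)ᗮ)
    (hh : h ∈ (closureRange A)ᗮ)
    (hf0 : ∀ j : ℕ, j ≤ n → fourierCoeff ((f : L2) : UnitAddCircle → ℂ) j = 0)
    (hh0 : ∀ j : ℕ, j < n → fourierCoeff ((h : L2) : UnitAddCircle → ℂ) j = 0)
    (hhn : fourierCoeff ((h : L2) : UnitAddCircle → ℂ) n ≠ 0) :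
    backShift θ f ∈ (closureRange A)ᗮ := by
  rw [mem_closureRange_orthogonal] at hf hh ⊢
  have hf00 := hf0 0 (Nat.zero_le n)
  rw [Nat.cast_zero] at hf00
  -- The case w = C p with p(0) = 0: the factor 1/z moves from f to p.
  have hval : ∀ w : K θ, fourierCoeff ((modelConj hθ w : L2) : UnitAddCircle → ℂ) 0 = 0 →
      ⟪backShift θ f, A w⟫_ℂ = 0 := fun w hw => by
    have := inner_toeplitz_shift hθ hA hw hf00
    rw [modelConj_modelConj, hf] at this
    exact this
  -- Starting from f/z^(n+1) paired with h in N, each step moves one factor 1/z from f to h. The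
  -- step from j to j+1 needs f/z^(n-j) and h/z^j to vanish at 0, which holds exactly as long as j <
  -- n for h.
  have hiter : ∀ j ≤ n,
      ⟪(backShift θ)^[j] h, A (modelConj hθ ((backShift θ)^[n + 1 - j] f))⟫_ℂ = 0 := by
    intro j
    induction j with
    | zero => exact fun _ => hh _
    | succ j ih =>
      intro hj
      have e : n + 1 - j = (n + 1 - (j + 1)).succ := by omega
      rw [Function.iterate_succ_apply', inner_toeplitz_shift hθ hA,
        ← Function.iterate_succ_apply' (f := backShift θ), ← e, ih (by omega)]
      · rw [fourierCoeff_backShift_iterate fun i hi => hf0 i (by omega), zero_add,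
          hf0 _ (by omega)]
      · rw [fourierCoeff_backShift_iterate fun i hi => hh0 i (by omega), zero_add,
          hh0 _ (by omega)]
  set h' := (backShift θ)^[n] h with hh'
  -- At j = n the pair is h/z^n and f/z; symmetry of B interchanges them.
  have hspecial : ⟪backShift θ f, A (modelConj hθ h')⟫_ℂ = 0 := by
    have := hiter n le_rfl
    rw [Nat.add_sub_cancel_left, Function.iterate_one] at this
    rw [inner_toeplitz_symm hθ hA, modelConj_modelConj]
    exact inner_toeplitz_symm hθ hA _ _ ▸ this
  have hh'0 : ⟪kernel hθ 0, h'⟫_ℂ ≠ 0 := by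
    rwa [inner_kernel_zero, hh', fourierCoeff_backShift_iterate hh0, zero_add]
  intro w
  -- Chosen so that C w - c h' vanishes at 0. The coefficient becomes conj c in front of C h'
  -- because C is antilinear.
  set c := ⟪kernel hθ 0, modelConj hθ w⟫_ℂ / ⟪kernel hθ 0, h'⟫_ℂ with hc
  have hw : ⟪backShift θ f, A (w - conj c • modelConj hθ h')⟫_ℂ = 0 := by
    refine hval _ ?_
    rw [modelConj_sub, modelConj_smul, modelConj_modelConj, Complex.conj_conj,
      ← inner_kernel_zero hθ, inner_sub_right, inner_K_smul_right, hc, div_mul_cancel₀ _ hh'0,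
      sub_self]
  rwa [map_sub, map_smul, inner_sub_right, inner_K_smul_right, hspecial, mul_zero, sub_zero] at hw

theorem orthogonal_orthogonal_closureRange {θ : L2} (A : K θ →L[ℂ] K θ) :
    (closureRange A)ᗮᗮ = closureRange A := by
  rw [Submodule.orthogonal_orthogonal_eq_closure]
  exact (Submodule.isClosed_topologicalClosure _).submodule_topologicalClosure_eq

theorem dbarKernel_zero_mem_iff {θ : L2} (hθ : IsInner θ) {A : K θ →L[ℂ] K θ} (n : ℕ) :
    dbarKernel hθ n 0 ∈ closureRange A ↔ ∀ f ∈ (closureRange A)ᗮ,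
      fourierCoeff ((f : L2) : UnitAddCircle → ℂ) n = 0 := by
  rw [dbarKernel_zero_eq, Submodule.smul_mem_iff _ (by exact_mod_cast n.factorial_ne_zero)]
  conv_lhs => rw [← orthogonal_orthogonal_closureRange A, Submodule.mem_orthogonal']
  simp only [inner_projMonomial]

/-- The image of the closed range under the restricted shift is contained in the sum of the closed
range and the line spanned by the first derivative of the kernel at the origin that is not in it. -/
theorem exists_map_S_closureRange_le (θ : L2) (hθ : IsInner θ) (A : K θ →L[ℂ] K θ)
    (hA : IsTruncatedToeplitz θ A) (hR : closureRange A ≠ ⊤) :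
    ∃ n : ℕ,
      IsGreatest {m : ℕ | ∀ j < m, dbarKernel hθ j 0 ∈ closureRange A} n ∧
      Disjoint (closureRange A) (Submodule.span ℂ {dbarKernel hθ n 0}) ∧
      (closureRange A).map (S θ : K θ →ₗ[ℂ] K θ) ≤
        closureRange A ⊔ Submodule.span ℂ {dbarKernel hθ n 0} := by
  classical
  have hex : ∃ n, dbarKernel hθ n 0 ∉ closureRange A := by
    by_contra! hcon
    refine hR ?_
    rw [← orthogonal_orthogonal_closureRange A, Submodule.orthogonal_eq_top_iff,
      Submodule.eq_bot_iff]
    refine fun f hf => eq_zero_of_inner_projMonomial fun n => ?_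
    rw [inner_projMonomial]
    exact (dbarKernel_zero_mem_iff hθ n).1 (hcon n) f hf
  have hn := Nat.find_spec hex
  have hlt : ∀ j < Nat.find hex, dbarKernel hθ j 0 ∈ closureRange A := fun j hj =>
    not_not.1 (Nat.find_min hex hj)
  set n := Nat.find hex
  refine ⟨n, ⟨hlt, fun m hm => not_lt.1 fun h => hn (hm n h)⟩,
    Submodule.disjoint_span_singleton_of_notMem hn, ?_⟩
  rintro _ ⟨x, hx, rfl⟩
  obtain ⟨h, hh, hhn⟩ : ∃ h ∈ (closureRange A)ᗮ,
      fourierCoeff ((h : L2) : UnitAddCircle → ℂ) n ≠ 0 := by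
    simpa only [dbarKernel_zero_mem_iff, not_forall, exists_prop] using hn
  have hzero : ∀ g ∈ (closureRange A)ᗮ, ∀ j < n,
      fourierCoeff ((g : L2) : UnitAddCircle → ℂ) j = 0 := fun g hg j hj =>
    (dbarKernel_zero_mem_iff hθ j).1 (hlt j hj) g hg
  have hd : ⟪h, projMonomial θ n⟫_ℂ ≠ 0 := fun h0 => hhn (by
    rw [← inner_projMonomial]; exact inner_eq_zero_symm.1 h0)
  -- Chosen to make the difference S_θ x - c P_θ(z^n) orthogonal to h.
  set c := ⟪h, S θ x⟫_ℂ / ⟪h, projMonomial θ n⟫_ℂ with hc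
  have hmem : S θ x - c • projMonomial θ n ∈ closureRange A := by
    rw [← orthogonal_orthogonal_closureRange A, Submodule.mem_orthogonal]
    intro g hg
    -- Splitting g as (g - β h) + β h reduces the test to two cases: g - β h has zero n-th
    -- coefficient, so division by z keeps it in the complement, and h is handled by the choice of
    -- c.
    set β := fourierCoeff ((g : L2) : UnitAddCircle → ℂ) n /
      fourierCoeff ((h : L2) : UnitAddCircle → ℂ) n with hβ
    have hgn : ⟪projMonomial θ n, g - β • h⟫_ℂ = 0 := by
      rw [inner_sub_right, inner_K_smul_right, inner_projMonomial, inner_projMonomial, hβ,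
        div_mul_cancel₀ _ hhn, sub_self]
    have hgβ : g - β • h ∈ (closureRange A)ᗮ :=
      Submodule.sub_mem _ hg (Submodule.smul_mem _ _ hh)
    have h1 : ⟪g - β • h, S θ x - c • projMonomial θ n⟫_ℂ = 0 := by
      rw [inner_sub_right, inner_K_smul_right, inner_eq_zero_symm.1 hgn, inner_S, mul_zero,
        sub_zero]
      refine (Submodule.mem_orthogonal' _ _).1 (backShift_mem_closureRange_orthogonal hθ hA hgβ hh
        (fun j hj => ?_) (hzero h hh) hhn) x hx
      rcases hj.lt_or_eq with hj | rfl
      · exact hzero _ hgβ j hj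
      · rwa [inner_projMonomial] at hgn
    have h2 : ⟪h, S θ x - c • projMonomial θ n⟫_ℂ = 0 := by
      rw [inner_sub_right, inner_K_smul_right, hc, div_mul_cancel₀ _ hd, sub_self]
    rwa [inner_sub_left, inner_K_smul_left, h2, mul_zero, sub_zero] at h1
  have hspan : c • projMonomial θ n ∈ Submodule.span ℂ {dbarKernel hθ n 0} := by
    rw [dbarKernel_zero_eq]
    -- The divisor n! undoes the factorial in the n-th derivative.
    refine Submodule.mem_span_singleton.2 ⟨c / (n.factorial : ℂ), ?_⟩
    rw [smul_smul, div_mul_cancel₀ _ (by exact_mod_cast n.factorial_ne_zero)]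
  have := Submodule.add_mem_sup hmem hspan
  rwa [sub_add_cancel] at this

end TruncatedToeplitz

end

theorem mainTheorem5 (θ : L2) (hθ : IsInner θ) (A : K θ →L[ℂ] K θ)
    (hA : IsTruncatedToeplitz θ A) (hR : closureRange A ≠ ⊤) :
    ∃ n : ℕ,
      IsGreatest {m : ℕ | ∀ j < m, dbarKernel hθ j 0 ∈ closureRange A} n ∧
      Disjoint (closureRange A) (Submodule.span ℂ {dbarKernel hθ n 0}) ∧
      (closureRange A).map (S θ : K θ →ₗ[ℂ] K θ) ≤
        closureRange A ⊔ Submodule.span ℂ {dbarKernel hθ n 0} :=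
  exists_map_S_closureRange_le θ hθ A hA hR
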